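/- Let $M\ge 2$, $L\ge 1$, $B_h\ge 0$ be integers. For unit vectors $x,y$ let $d_c(x,y)=\sqrt{1-|x^{T}y|^2}$ be the chordal distance; points of the Grassmann manifold of lines are represented by unit vectors. Let $f$ be uniformly distributed on the unit sphere of $\mathbb R^{ML}$, split it into $M$ blocks $v_1,\dots,v_M\in\mathbb R^{L}$, and let $h=(\|v_1\|,\dots,\|v_M\|)^T\in\mathbb R^M$ be its hinge vector. Put $h_{\rm ref}=M^{-1/2}(1,\dots,1)^T\in\mathbb R^M$. Let $N'$ be an integer with $$N'\ \ge\ \Big\lfloor 2^{B_h+1}L^{\frac{M-1}{4}+1}\Big(\frac{M-1}{2}\Big)^{1/2}\sqrt{\pi}\Big\rfloor$$ (in particular $N'\ge 2^{B_h}$). Draw $N'$ independent uniformly distributed unit vectors in $\mathbb R^M$, independent of $f$, and let the codebook $\mathcal C_h$ consist of the $2^{B_h}$ of them that are closest to $h_{\rm ref}$ in chordal distance (ties broken in any measurable way). Let $\mathsf Q_{\mathcal C_h}(h)$ be a codeword of $\mathcal C_h$ at the smallest chordal distance from $h$. Then $d_c^2(h,\mathsf Q_{\mathcal C_h}(h))$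 is integrable and its expectation over $f$ and over the random codebook satisfies $$\mathbb E\big[d_c^2\big(h,\mathsf Q_{\mathcal C_h}(h)\big)\big]\ \le\ L^{-1/2}\Big(\beta_L\,2^{-\frac{2B_h}{M-1}}+1\Big)+K\,L^{-3/2},$$ $$\beta_L=\frac{1+r^{1/2}}{1-r^{1/2}},\qquad r=\sqrt{\frac{2}{1+2L^{1/4}}},$$ where $K$ is an absolute constant (independent of $L$, $M$, $B_h$ and $N'$). -/

import Mathlib

open MeasureTheory ProbabilityTheory

noncomputable section

/-- The unit sphere of the Euclidean space `ℝ^ι`. A point of the Grassmann manifold of lines is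
represented, as usual for Grassmannian codebooks, by a unit vector. -/
abbrev UnitVec (ι : Type*) [Fintype ι] : Type _ :=
  Metric.sphere (0 : EuclideanSpace ℝ ι) 1

/-- The uniform distribution on unit vectors: the surface measure of the unit sphere,
normalized to total mass one. -/
def uniformLaw (ι : Type*) [Fintype ι] : Measure (UnitVec ι) :=
  ((volume : Measure (EuclideanSpace ℝ ι)).toSphere Set.univ)⁻¹ •
    (volume : Measure (EuclideanSpace ℝ ι)).toSphere

/-- The chordal distance `√(1 - |xᵀ y|²)` between (the lines of) two unit vectors. -/
def chordalDist {ι : Type*} [Fintype ι] (x y : EuclideanSpace ℝ ι) : ℝ :=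
  √(1 - |inner ℝ x y| ^ 2)

/-- The `i`-th block, of length `L`, of a vector with `M * L` coordinates. -/
def block {M L : ℕ} (f : EuclideanSpace ℝ (Fin M × Fin L)) (i : Fin M) :
    EuclideanSpace ℝ (Fin L) :=
  WithLp.toLp 2 fun j => f (i, j)

/-- The hinge vector: the vector of the norms of the `M` blocks. -/
def hingeVector {M L : ℕ} (f : EuclideanSpace ℝ (Fin M × Fin L)) : EuclideanSpace ℝ (Fin M) :=
  WithLp.toLp 2 fun i => ‖block f i‖

/-- The reference vector `(1, …, 1) / √M`. -/
def hRef (M : ℕ) : EuclideanSpace ℝ (Fin M) :=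
  WithLp.toLp 2 fun _ => 1 / √(M : ℝ)

/-- `S` is the set of the indices of `N` points, among the given points, that are closest to `ref`
in chordal distance. -/
structure IsNearestSelection {ι κ : Type*} [Fintype ι] (ref : EuclideanSpace ℝ ι)
    (c : κ → UnitVec ι) (N : ℕ) (S : Finset κ) : Prop where
  card_eq : S.card = N
  nearest : ∀ i ∈ S, ∀ j ∉ S, chordalDist ref (c i) ≤ chordalDist ref (c j)

/-- `y` is a codeword of the codebook `C` at the smallest chordal distance from `x`. -/
def IsChordalQuantization {ι : Type*} [Fintype ι] (C : Set (UnitVec ι))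
    (x : EuclideanSpace ℝ ι) (y : UnitVec ι) : Prop :=
  y ∈ C ∧ ∀ z ∈ C, chordalDist x y ≤ chordalDist x z

/-- The radius `r = √(2 / (1 + 2 L^{1/4}))`. -/
def hingeRadius (L : ℕ) : ℝ :=
  √(2 / (1 + 2 * (L : ℝ) ^ (1 / 4 : ℝ)))

/-- The factor `β_L = (1 + r^{1/2}) / (1 - r^{1/2})`. -/
def hingeBeta (L : ℕ) : ℝ :=
  (1 + hingeRadius L ^ (1 / 2 : ℝ)) / (1 - hingeRadius L ^ (1 / 2 : ℝ))

/-- The number of points to be drawn, `2^{B+1} L^{(M-1)/4+1} ((M-1)/2)^{1/2} √π`,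
before rounding to an integer. -/
def sampleSize (M L B : ℕ) : ℝ :=
  2 ^ (B + 1) * (L : ℝ) ^ (((M : ℝ) - 1) / 4 + 1) * (((M : ℝ) - 1) / 2) ^ (1 / 2 : ℝ) * √Real.pi

end

/-! Compare everything with the reference vector. If `δ` is the chordal distance from the hinge
vector to `hRef` and some drawn point lies within `ρ` of `hRef`, then some codeword does too, and
the triangle inequality bounds the quantization error by `δ + ρ`.

The term `δ` is small by concentration: `E[δ²] ≤ 2 / L`, because `δ²` is at most the empirical
variance of the normalized block energies, whose mean comes from fourth moments on the sphere
(`integral_chordalDist_hingeVector_hRef_sq_le`). The radius is `ρ = 2^{-B/(M-1)} L^{-1/4}`, so that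
`ρ²` is the main term of the bound without `β_L ≥ 1`. A cone inside the ball bounds the mass of a
chordal ball of radius `ρ` from below (`uniformLaw_chordalBall_ge`). With the prescribed sample size
the expected number of points in that ball is at least `L / 4`, so by independence all points miss
it with probability at most `exp (-L / 4) = O(L^{-3/2})` (`measureReal_forall_far_le`).

Finally `(δ + ρ)² ≤ 3 δ² + (3 / 2) ρ²`. Since `ρ² ≤ L^{-1/2}`, the excess `ρ² / 2` costs half of the
allowed `L^{-1/2}`; for `L ≥ 144` the other half covers `3 E[δ²] ≤ 6 / L`. Smaller `L` are absorbed
by the constant. -/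

/-! ### The uniform law on the sphere and its isometry invariance. -/

open scoped Pointwise in
/-- The uniform law of a set is the proportion of the unit ball filled by the cone over the set. -/
theorem uniformLaw_apply {ι : Type*} [Fintype ι] [Nonempty ι] {s : Set (UnitVec ι)}
    (hs : MeasurableSet s) :
    uniformLaw ι s = volume (Set.Ioo (0 : ℝ) 1 • (((↑) : UnitVec ι → EuclideanSpace ℝ ι) '' s)) /
      volume (Metric.ball (0 : EuclideanSpace ℝ ι) 1) := by
  have h0 : ((Module.finrank ℝ (EuclideanSpace ℝ ι) : ℕ) : ENNReal) ≠ 0 := by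
    simp
  have h1 : ((Module.finrank ℝ (EuclideanSpace ℝ ι) : ℕ) : ENNReal) ≠ ⊤ := by simp
  rw [uniformLaw, Measure.smul_apply, Measure.toSphere_apply_univ, Measure.toSphere_apply' _ hs,
    smul_eq_mul, mul_comm, ← div_eq_mul_inv, ENNReal.mul_div_mul_left _ _ h0 h1]

instance isProbabilityMeasure_uniformLaw (ι : Type*) [Fintype ι] [Nonempty ι] :
    IsProbabilityMeasure (uniformLaw ι) := by
  refine ⟨?_⟩
  rw [uniformLaw, Measure.smul_apply, smul_eq_mul]
  refine ENNReal.inv_mul_cancel ?_ (measure_ne_top _ _)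
  rw [Measure.measure_univ_ne_zero]
  exact Measure.toSphere_ne_zero _

/-- The homeomorphism of the unit sphere induced by a linear isometry. -/
noncomputable def sphereHomeomorph {ι : Type*} [Fintype ι]
    (A : EuclideanSpace ℝ ι ≃ₗᵢ[ℝ] EuclideanSpace ℝ ι) : UnitVec ι ≃ₜ UnitVec ι where
  toFun x := ⟨A x, by simp⟩
  invFun x := ⟨A.symm x, by simp⟩
  left_inv x := by simp
  right_inv x := by simp
  continuous_toFun := by fun_prop
  continuous_invFun := by fun_prop

@[simp]
theorem coe_sphereHomeomorph {ι : Type*} [Fintype ι]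
    (A : EuclideanSpace ℝ ι ≃ₗᵢ[ℝ] EuclideanSpace ℝ ι) (x : UnitVec ι) :
    (sphereHomeomorph A x : EuclideanSpace ℝ ι) = A x := rfl

open scoped Pointwise in
/-- The uniform law on unit vectors is invariant under linear isometries. -/
theorem measurePreserving_sphereHomeomorph {ι : Type*} [Fintype ι] [Nonempty ι]
    (A : EuclideanSpace ℝ ι ≃ₗᵢ[ℝ] EuclideanSpace ℝ ι) :
    MeasurePreserving (sphereHomeomorph A) (uniformLaw ι) (uniformLaw ι) := by
  refine ⟨(sphereHomeomorph A).continuous.measurable, ?_⟩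
  ext s hs
  rw [Measure.map_apply (sphereHomeomorph A).continuous.measurable hs,
    uniformLaw_apply ((sphereHomeomorph A).continuous.measurable hs), uniformLaw_apply hs]
  congr 1
  have : Set.Ioo (0 : ℝ) 1 • (((↑) : UnitVec ι → EuclideanSpace ℝ ι) '' (sphereHomeomorph A ⁻¹' s))
      = A.toMeasurableEquiv ⁻¹'
        (Set.Ioo (0 : ℝ) 1 • (((↑) : UnitVec ι → EuclideanSpace ℝ ι) '' s)) := by
    ext y
    simp only [Set.mem_smul, Set.mem_image, Set.mem_preimage]
    constructor
    · rintro ⟨t, ht, _, ⟨x, hx, rfl⟩, rfl⟩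
      exact ⟨t, ht, _, ⟨_, hx, rfl⟩, by simp⟩
    · rintro ⟨t, ht, _, ⟨x, hx, rfl⟩, h⟩
      refine ⟨t, ht, _, ⟨(sphereHomeomorph A).symm x, by simpa using hx, rfl⟩, ?_⟩
      have h' : t • (x : EuclideanSpace ℝ ι) = A y := h
      have h2 : (((sphereHomeomorph A).symm x : UnitVec ι) : EuclideanSpace ℝ ι) = A.symm x := rfl
      rw [h2, ← map_smul, h', A.symm_apply_apply]
  rw [this]
  exact A.measurePreserving.measure_preimage_equiv (f := A.toMeasurableEquiv) _

/-- Any two unit vectors are exchanged by a linear isometry. -/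
theorem exists_isometry_map_eq {E : Type*} [NormedAddCommGroup E] [InnerProductSpace ℝ E]
    {v w : E} (h : ‖v‖ = ‖w‖) : ∃ A : E ≃ₗᵢ[ℝ] E, A v = w :=
  -- The reflection in the hyperplane orthogonal to `v - w` does it.
  ⟨_, Submodule.reflection_sub h⟩

/-! ### Fourth moments on the sphere. -/

theorem integral_inner_pow_four_eq_of_norm_eq {ι : Type*} [Fintype ι] [Nonempty ι]
    {v w : EuclideanSpace ℝ ι} (h : ‖v‖ = ‖w‖) :
    ∫ x, (inner ℝ v (x : EuclideanSpace ℝ ι)) ^ 4 ∂uniformLaw ι =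
      ∫ x, (inner ℝ w (x : EuclideanSpace ℝ ι)) ^ 4 ∂uniformLaw ι := by
  obtain ⟨A, rfl⟩ := exists_isometry_map_eq h
  rw [← (measurePreserving_sphereHomeomorph A).integral_comp
    (sphereHomeomorph A).measurableEmbedding fun x : UnitVec ι =>
      (inner ℝ (A v) (x : EuclideanSpace ℝ ι)) ^ 4]
  simp

/-- The fourth moment of a linear form on the unit sphere. -/
theorem integral_inner_pow_four {ι : Type*} [Fintype ι] [Nonempty ι]
    (v : EuclideanSpace ℝ ι) {e : EuclideanSpace ℝ ι} (he : ‖e‖ = 1) :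
    ∫ x, (inner ℝ v (x : EuclideanSpace ℝ ι)) ^ 4 ∂uniformLaw ι =
      ‖v‖ ^ 4 * ∫ x, (inner ℝ e (x : EuclideanSpace ℝ ι)) ^ 4 ∂uniformLaw ι := by
  rw [integral_inner_pow_four_eq_of_norm_eq (w := ‖v‖ • e) (by simp [norm_smul, he]),
    ← integral_const_mul]
  simp [inner_smul_left, mul_pow]

theorem integrable_uniformLaw {ι : Type*} [Fintype ι] [Nonempty ι] {g : UnitVec ι → ℝ}
    (hg : Continuous g) : Integrable g (uniformLaw ι) := by
  obtain ⟨C, hC⟩ := isCompact_univ.exists_bound_of_continuousOn hg.continuousOn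
  exact Integrable.of_bound hg.aestronglyMeasurable C (ae_of_all _ fun x => hC x trivial)

/-- Mixed moments reduce to the fourth moment `A` of one linear form by polarization: for `i ≠ j`
the forms `x i ± x j` have squared norm 2, so `8 A = 4 A + 12 E[x i ² x j ²]`. -/
theorem integral_coord_sq_mul_coord_sq {ι : Type*} [Fintype ι] [Nonempty ι] [DecidableEq ι]
    {e : EuclideanSpace ℝ ι} (he : ‖e‖ = 1) (i j : ι) :
    ∫ x : UnitVec ι, ((x : EuclideanSpace ℝ ι) i) ^ 2 * ((x : EuclideanSpace ℝ ι) j) ^ 2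
      ∂uniformLaw ι =
      (∫ x, (inner ℝ e (x : EuclideanSpace ℝ ι)) ^ 4 ∂uniformLaw ι) *
        (if i = j then 1 else 1 / 3) := by
  have hs (k : ι) := integral_inner_pow_four (EuclideanSpace.single k (1 : ℝ)) he
  simp only [EuclideanSpace.inner_single_left, map_one, one_mul, PiLp.norm_single, norm_one,
    one_pow] at hs
  split_ifs with h
  · subst h
    rw [mul_one, ← hs i]
    exact integral_congr_ae (ae_of_all _ fun x => by ring)
  have hp := integral_inner_pow_four
    (EuclideanSpace.single i (1 : ℝ) + EuclideanSpace.single j (1 : ℝ)) he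
  have hm := integral_inner_pow_four
    (EuclideanSpace.single i (1 : ℝ) - EuclideanSpace.single j (1 : ℝ)) he
  have h4 (v : EuclideanSpace ℝ ι) : ‖v‖ ^ 4 = (∑ k, v k ^ 2) ^ 2 := by
    rw [← EuclideanSpace.real_norm_sq_eq]; ring
  have hn : ∑ k, ((EuclideanSpace.single i (1 : ℝ) + EuclideanSpace.single j (1 : ℝ)) k) ^ 2
      = 2 := by
    have : ∀ k, ((EuclideanSpace.single i (1 : ℝ) + EuclideanSpace.single j (1 : ℝ)) k) ^ 2 =
        (if k = i then 1 else 0) + (if k = j then 1 else 0) := by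
      intro k
      by_cases h1 : k = i <;> by_cases h2 : k = j <;> simp_all
    simp only [this, Finset.sum_add_distrib]
    norm_num
  have hn' : ∑ k, ((EuclideanSpace.single i (1 : ℝ) - EuclideanSpace.single j (1 : ℝ)) k) ^ 2
      = 2 := by
    have : ∀ k, ((EuclideanSpace.single i (1 : ℝ) - EuclideanSpace.single j (1 : ℝ)) k) ^ 2 =
        (if k = i then 1 else 0) + (if k = j then 1 else 0) := by
      intro k
      by_cases h1 : k = i <;> by_cases h2 : k = j <;> simp_all
    simp only [this, Finset.sum_add_distrib]
    norm_num
  rw [h4, hn] at hp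
  rw [h4, hn'] at hm
  simp only [inner_add_left, inner_sub_left, EuclideanSpace.inner_single_left, map_one,
    one_mul] at hp hm
  have key : ∫ x : UnitVec ι, (((x : EuclideanSpace ℝ ι) i + (x : EuclideanSpace ℝ ι) j) ^ 4 +
      ((x : EuclideanSpace ℝ ι) i - (x : EuclideanSpace ℝ ι) j) ^ 4) ∂uniformLaw ι =
      ∫ x : UnitVec ι, (2 * ((x : EuclideanSpace ℝ ι) i) ^ 4 +
        2 * ((x : EuclideanSpace ℝ ι) j) ^ 4 +
        12 * (((x : EuclideanSpace ℝ ι) i) ^ 2 * ((x : EuclideanSpace ℝ ι) j) ^ 2))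
        ∂uniformLaw ι :=
    integral_congr_ae (ae_of_all _ fun x => by ring)
  rw [integral_add (integrable_uniformLaw (by fun_prop)) (integrable_uniformLaw (by fun_prop)),
    integral_add (integrable_uniformLaw (by fun_prop)) (integrable_uniformLaw (by fun_prop)),
    integral_add (integrable_uniformLaw (by fun_prop)) (integrable_uniformLaw (by fun_prop)),
    integral_const_mul, integral_const_mul, integral_const_mul, hp, hm, hs i, hs j] at key
  linarith

/-- The second moment of the squared norm of a projection of a random unit vector to a coordinate
subspace. -/
theorem integral_sum_coord_sq_sq {ι : Type*} [Fintype ι] [Nonempty ι] (s : Finset ι) :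
    ∫ x : UnitVec ι, (∑ i ∈ s, ((x : EuclideanSpace ℝ ι) i) ^ 2) ^ 2 ∂uniformLaw ι =
      (s.card * (s.card + 2) : ℝ) / (Fintype.card ι * (Fintype.card ι + 2)) := by
  classical
  obtain ⟨e, he⟩ : ∃ e : EuclideanSpace ℝ ι, ‖e‖ = 1 :=
    ⟨EuclideanSpace.single (Classical.arbitrary ι) 1, by simp⟩
  set A := ∫ x, (inner ℝ e (x : EuclideanSpace ℝ ι)) ^ 4 ∂uniformLaw ι with hA
  have key (s : Finset ι) :
      ∫ x : UnitVec ι, (∑ i ∈ s, ((x : EuclideanSpace ℝ ι) i) ^ 2) ^ 2 ∂uniformLaw ι =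
        A / 3 * (s.card * (s.card + 2)) := by
    simp_rw [sq (∑ i ∈ s, _), Finset.sum_mul_sum]
    rw [integral_finsetSum _ fun i _ => integrable_uniformLaw (by fun_prop)]
    have : ∀ i ∈ s, ∫ x : UnitVec ι, ∑ j ∈ s, ((x : EuclideanSpace ℝ ι) i) ^ 2 *
        ((x : EuclideanSpace ℝ ι) j) ^ 2 ∂uniformLaw ι = A / 3 * (s.card + 2) := by
      intro i hi
      rw [integral_finsetSum _ fun i _ => integrable_uniformLaw (by fun_prop)]
      have h3 : ∀ j ∈ s, ∫ x : UnitVec ι, ((x : EuclideanSpace ℝ ι) i) ^ 2 *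
          ((x : EuclideanSpace ℝ ι) j) ^ 2 ∂uniformLaw ι =
          A / 3 + (if i = j then A * (2 / 3) else 0) := by
        intro j _
        rw [integral_coord_sq_mul_coord_sq he, ← hA]
        split_ifs <;> ring
      rw [Finset.sum_congr rfl h3, Finset.sum_add_distrib, Finset.sum_ite_eq, if_pos hi,
        Finset.sum_const, nsmul_eq_mul]
      ring
    rw [Finset.sum_congr rfl this, Finset.sum_const, nsmul_eq_mul]
    ring
  -- Taking all coordinates, where the sum of squares is 1, determines `A`.
  have h1 : (1 : ℝ) = A / 3 * (Fintype.card ι * (Fintype.card ι + 2)) := by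
    rw [← Finset.card_univ, ← key]
    have : ∀ x : UnitVec ι, (∑ i, ((x : EuclideanSpace ℝ ι) i) ^ 2) ^ 2 = 1 := by
      intro x
      rw [← EuclideanSpace.real_norm_sq_eq]
      simp
    simp [this]
  have hc : (0 : ℝ) < Fintype.card ι := by exact_mod_cast Fintype.card_pos
  rw [key, eq_div_iff (by positivity)]
  linear_combination (-(s.card * (s.card + 2) : ℝ)) * h1

/-! ### The chordal distance as a distance to a line. -/

theorem chordalDist_nonneg {ι : Type*} [Fintype ι] (x y : EuclideanSpace ℝ ι) :
    0 ≤ chordalDist x y := Real.sqrt_nonneg _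

theorem chordalDist_sq {ι : Type*} [Fintype ι] {x y : EuclideanSpace ℝ ι}
    (hx : ‖x‖ = 1) (hy : ‖y‖ = 1) : chordalDist x y ^ 2 = 1 - inner ℝ x y ^ 2 := by
  have := abs_real_inner_le_norm x y
  rw [hx, hy] at this
  rw [chordalDist, Real.sq_sqrt (by nlinarith [abs_nonneg (inner ℝ x y)]), sq_abs]

theorem chordalDist_le_one {ι : Type*} [Fintype ι] (x y : EuclideanSpace ℝ ι) :
    chordalDist x y ≤ 1 := by
  rw [chordalDist, Real.sqrt_le_one]
  nlinarith [sq_nonneg |inner ℝ x y|]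

/-- The chordal distance is the distance to the line. -/
theorem chordalDist_eq_norm {ι : Type*} [Fintype ι] {x y : EuclideanSpace ℝ ι}
    (hx : ‖x‖ = 1) (hy : ‖y‖ = 1) : chordalDist x y = ‖x - inner ℝ x y • y‖ := by
  rw [← sq_eq_sq₀ (chordalDist_nonneg _ _) (norm_nonneg _), chordalDist_sq hx hy,
    norm_sub_sq_real, inner_smul_right, norm_smul, hx, hy, Real.norm_eq_abs, mul_one, sq_abs]
  ring

theorem chordalDist_le_norm {ι : Type*} [Fintype ι] {x y : EuclideanSpace ℝ ι}
    (hx : ‖x‖ = 1) (hy : ‖y‖ = 1) (t : ℝ) : chordalDist x y ≤ ‖x - t • y‖ := by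
  rw [← sq_le_sq₀ (chordalDist_nonneg _ _) (norm_nonneg _), chordalDist_sq hx hy,
    norm_sub_sq_real, inner_smul_right, norm_smul, hx, hy, Real.norm_eq_abs, mul_one, sq_abs]
  nlinarith [sq_nonneg (inner ℝ x y - t)]

/-- Project `x` to the line of `y` and the result to the line of `z`: this gives a point of the line
of `z`, and the second displacement is scaled by `|⟨x, y⟩| ≤ 1`. -/
theorem chordalDist_triangle {ι : Type*} [Fintype ι] {x y z : EuclideanSpace ℝ ι}
    (hx : ‖x‖ = 1) (hy : ‖y‖ = 1) (hz : ‖z‖ = 1) :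
    chordalDist x z ≤ chordalDist x y + chordalDist y z := by
  have h1 : |inner ℝ x y| ≤ 1 := by
    have := abs_real_inner_le_norm x y
    rwa [hx, hy, one_mul] at this
  calc chordalDist x z ≤ ‖x - (inner ℝ x y * inner ℝ y z) • z‖ := chordalDist_le_norm hx hz _
    _ = ‖(x - inner ℝ x y • y) + inner ℝ x y • (y - inner ℝ y z • z)‖ := by
        congr 1; module
    _ ≤ ‖x - inner ℝ x y • y‖ + |inner ℝ x y| * ‖y - inner ℝ y z • z‖ := by
        refine (norm_add_le _ _).trans_eq ?_
        rw [norm_smul, Real.norm_eq_abs]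
    _ ≤ chordalDist x y + chordalDist y z := by
        rw [chordalDist_eq_norm hx hy, chordalDist_eq_norm hy hz]
        gcongr
        exact mul_le_of_le_one_left (norm_nonneg _) h1

theorem continuous_chordalDist {ι : Type*} [Fintype ι] :
    Continuous fun p : EuclideanSpace ℝ ι × EuclideanSpace ℝ ι => chordalDist p.1 p.2 := by
  unfold chordalDist
  fun_prop

/-! ### Concentration of the hinge vector. -/

theorem norm_block_sq {M L : ℕ} (f : EuclideanSpace ℝ (Fin M × Fin L)) (i : Fin M) :
    ‖block f i‖ ^ 2 = ∑ j, f (i, j) ^ 2 := by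
  simp [EuclideanSpace.real_norm_sq_eq, block]

theorem norm_hingeVector {M L : ℕ} (f : EuclideanSpace ℝ (Fin M × Fin L)) :
    ‖hingeVector f‖ = ‖f‖ := by
  rw [← sq_eq_sq₀ (norm_nonneg _) (norm_nonneg _), EuclideanSpace.real_norm_sq_eq,
    EuclideanSpace.real_norm_sq_eq, Fintype.sum_prod_type]
  exact Finset.sum_congr rfl fun i _ => norm_block_sq f i

theorem norm_hRef {M : ℕ} (hM : M ≠ 0) : ‖hRef M‖ = 1 := by
  rw [← sq_eq_sq₀ (norm_nonneg _) zero_le_one, EuclideanSpace.real_norm_sq_eq]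
  simp [hRef, hM]

theorem continuous_hingeVector {M L : ℕ} :
    Continuous (hingeVector : EuclideanSpace ℝ (Fin M × Fin L) → EuclideanSpace ℝ (Fin M)) := by
  unfold hingeVector block
  fun_prop

/-- The squared chordal distance of the hinge vector from the reference vector is at most the
empirical variance of the normalized block energies. -/
theorem chordalDist_hingeVector_hRef_sq_le {M L : ℕ} (hM : M ≠ 0)
    {f : EuclideanSpace ℝ (Fin M × Fin L)} (hf : ‖f‖ = 1) :
    chordalDist (hingeVector f) (hRef M) ^ 2 ≤ M * ∑ i, (∑ j, f (i, j) ^ 2) ^ 2 - 1 := by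
  have hM0 : (0 : ℝ) < M := by positivity
  have hn : ‖hingeVector f‖ = 1 := by rw [norm_hingeVector, hf]
  rw [chordalDist_sq hn (norm_hRef hM)]
  set a : Fin M → ℝ := fun i => √M * ‖block f i‖ with ha
  have ha0 : ∀ i, 0 ≤ a i := fun i => by positivity
  have ha2 : ∀ i, a i ^ 2 = M * ∑ j, f (i, j) ^ 2 := fun i => by
    rw [ha, mul_pow, Real.sq_sqrt hM0.le, norm_block_sq]
  have hsum : ∑ i, a i ^ 2 = M := by
    simp_rw [ha2, ← Finset.mul_sum]
    have : ∑ i, ∑ j, f (i, j) ^ 2 = 1 := by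
      rw [← Fintype.sum_prod_type (f := fun p => f p ^ 2), ← EuclideanSpace.real_norm_sq_eq, hf,
        one_pow]
    rw [this, mul_one]
  have hx : inner ℝ (hingeVector f) (hRef M) = (∑ i, a i) / M := by
    simp only [PiLp.inner_apply, hingeVector, hRef, ha, RCLike.inner_apply, conj_trivial]
    rw [Finset.sum_div]
    refine Finset.sum_congr rfl fun i _ => ?_
    field_simp
    rw [Real.sq_sqrt hM0.le, mul_comm]
  have h4 : ∑ i, (∑ j, f (i, j) ^ 2) ^ 2 = (∑ i, a i ^ 4) / M ^ 2 := by
    rw [Finset.sum_div]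
    refine Finset.sum_congr rfl fun i _ => ?_
    rw [show a i ^ 4 = (a i ^ 2) ^ 2 by ring, ha2]
    field_simp
  -- The difference of the two sides is `a (a - 1)² (a + 2)`, with a double zero at the typical
  -- value `a = 1`.
  have hlow : ∀ i, 2 * a i ≥ 3 * a i ^ 2 - a i ^ 4 := fun i => by
    nlinarith [mul_nonneg (mul_nonneg (ha0 i) (sq_nonneg (a i - 1))) (by linarith [ha0 i] :
      (0 : ℝ) ≤ a i + 2)]
  have hs : 2 * ∑ i, a i ≥ 3 * M - ∑ i, a i ^ 4 := by
    rw [Finset.mul_sum, ← hsum, Finset.mul_sum, ← Finset.sum_sub_distrib]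
    exact Finset.sum_le_sum fun i _ => hlow i
  rw [hx, h4]
  set s := ∑ i, a i
  set q := ∑ i, a i ^ 4
  have e1 : (M : ℝ) * (q / M ^ 2) = q / M := by field_simp
  rw [e1]
  have e2 : 3 - q / M ≤ 2 * (s / M) := by
    rw [sub_le_iff_le_add, ← mul_div_assoc, ← add_div, le_div_iff₀ hM0]
    linarith
  -- Linearize the squared inner product: `(s / M)² ≥ 2 (s / M) - 1`.
  nlinarith [sq_nonneg (s / M - 1)]

/-- The hinge vector concentrates at the reference vector. -/
theorem integral_chordalDist_hingeVector_hRef_sq_le {M L : ℕ} (hM : 1 ≤ M) (hL : 1 ≤ L) :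
    ∫ x : UnitVec (Fin M × Fin L),
      chordalDist (hingeVector (x : EuclideanSpace ℝ (Fin M × Fin L))) (hRef M) ^ 2
        ∂uniformLaw (Fin M × Fin L) ≤ 2 / L := by
  have : Nonempty (Fin M × Fin L) := ⟨(⟨0, hM⟩, ⟨0, hL⟩)⟩
  have hM0 : (0 : ℝ) < M := by exact_mod_cast hM
  have hL0 : (0 : ℝ) < L := by exact_mod_cast hL
  have hblock (i : Fin M) : ∫ x : UnitVec (Fin M × Fin L),
      (∑ j, (x : EuclideanSpace ℝ (Fin M × Fin L)) (i, j) ^ 2) ^ 2 ∂uniformLaw (Fin M × Fin L) =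
        (L * (L + 2) : ℝ) / ((M * L) * (M * L + 2)) := by
    have h := integral_sum_coord_sq_sq
      (Finset.univ.map ⟨fun j : Fin L => (i, j), Prod.mk_right_injective i⟩)
    simpa using h
  calc _ ≤ ∫ x : UnitVec (Fin M × Fin L),
        (M * ∑ i, (∑ j, (x : EuclideanSpace ℝ (Fin M × Fin L)) (i, j) ^ 2) ^ 2 - 1)
          ∂uniformLaw (Fin M × Fin L) := by
        refine integral_mono (integrable_uniformLaw ?_) (integrable_uniformLaw (by fun_prop))
          fun x => chordalDist_hingeVector_hRef_sq_le (by omega) (by simp)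
        exact (continuous_chordalDist.comp ((continuous_hingeVector.comp
          continuous_subtype_val).prodMk continuous_const)).pow 2
    _ = M * (M * ((L * (L + 2) : ℝ) / ((M * L) * (M * L + 2)))) - 1 := by
        rw [integral_sub (integrable_uniformLaw (by fun_prop)) (integrable_const _),
          integral_const_mul, integral_finsetSum _ fun i _ => integrable_uniformLaw (by fun_prop)]
        simp [hblock]
    _ = (2 * M - 2) / (M * L + 2) := by field_simp; ring
    _ ≤ 2 / L := by
        rw [div_le_div_iff₀ (by positivity) hL0]
        nlinarith

/-! ### Volumes of balls and cones, and the mass of a chordal ball. -/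

/-- A consequence of the log-convexity of the Gamma function. -/
theorem sqrt_mul_Gamma_add_half_le {x : ℝ} (hx : 0 < x) :
    √x * Real.Gamma (x + 1 / 2) ≤ Real.Gamma (x + 1) := by
  have h := Real.Gamma_mul_add_mul_le_rpow_Gamma_mul_rpow_Gamma hx (by linarith : 0 < x + 1)
    (by norm_num : (0 : ℝ) < 1 / 2) (by norm_num : (0 : ℝ) < 1 / 2) (by norm_num)
  rw [← Real.sqrt_eq_rpow, ← Real.sqrt_eq_rpow, show 1 / 2 * x + 1 / 2 * (x + 1) = x + 1 / 2 by ring,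
    Real.Gamma_add_one hx.ne', Real.sqrt_mul hx.le] at h
  have hG := (Real.Gamma_pos_of_pos hx).le
  calc √x * Real.Gamma (x + 1 / 2)
      ≤ √x * (√(Real.Gamma x) * (√x * √(Real.Gamma x))) := by gcongr
    _ = (√x * √x) * (√(Real.Gamma x) * √(Real.Gamma x)) := by ring
    _ = Real.Gamma (x + 1) := by
        rw [Real.mul_self_sqrt hx.le, Real.mul_self_sqrt hG, Real.Gamma_add_one hx.ne']

/-- The volume of the unit ball of `ℝⁿ`. -/
noncomputable def unitBallVolume (n : ℕ) : ℝ := √Real.pi ^ n / Real.Gamma (n / 2 + 1)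

theorem unitBallVolume_pos (n : ℕ) : 0 < unitBallVolume n := by
  unfold unitBallVolume
  have := Real.Gamma_pos_of_pos (by positivity : (0 : ℝ) < n / 2 + 1)
  positivity

/-- The Gamma inequality at `x = (n + 1) / 2`. It removes the ball volumes from the estimate of a
cap. -/
theorem sqrt_mul_unitBallVolume_succ_le (n : ℕ) :
    √((n + 1) / (2 * Real.pi)) * unitBallVolume (n + 1) ≤ unitBallVolume n := by
  have h := sqrt_mul_Gamma_add_half_le (by positivity : (0 : ℝ) < (n + 1) / 2)
  rw [show ((n : ℝ) + 1) / 2 + 1 / 2 = n / 2 + 1 by ring] at h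
  have h1 := Real.Gamma_pos_of_pos (by positivity : (0 : ℝ) < n / 2 + 1)
  have h2 := Real.Gamma_pos_of_pos (by positivity : (0 : ℝ) < ((n : ℝ) + 1) / 2 + 1)
  have e : √(((n : ℝ) + 1) / (2 * Real.pi)) = √((n + 1) / 2) / √Real.pi := by
    rw [← div_div, Real.sqrt_div (by positivity)]
  unfold unitBallVolume
  rw [e]
  push_cast
  have hpi : 0 < √Real.pi := Real.sqrt_pos.2 Real.pi_pos
  rw [div_mul_div_comm, div_le_div_iff₀ (by positivity) h1, pow_succ]
  calc √(((n : ℝ) + 1) / 2) * (√Real.pi ^ n * √Real.pi) * Real.Gamma (n / 2 + 1)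
      = √Real.pi ^ n * √Real.pi * (√(((n : ℝ) + 1) / 2) * Real.Gamma (n / 2 + 1)) := by ring
    _ ≤ √Real.pi ^ n * √Real.pi * Real.Gamma ((n + 1) / 2 + 1) := by gcongr
    _ = _ := by ring

theorem volume_sum_sq_le {m : ℕ} (hm : m ≠ 0) {R : ℝ} (hR : 0 ≤ R) :
    volume {z : Fin m → ℝ | ∑ j, z j ^ 2 ≤ R ^ 2} = ENNReal.ofReal (unitBallVolume m * R ^ m) := by
  have : Nonempty (Fin m) := ⟨⟨0, Nat.pos_of_ne_zero hm⟩⟩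
  have h := EuclideanSpace.volume_closedBall (Fin m) 0 R
  rw [← (PiLp.volume_preserving_toLp (Fin m)).measure_preimage
    Metric.isClosed_closedBall.measurableSet.nullMeasurableSet, Fintype.card_fin,
    ← ENNReal.ofReal_pow hR, ← ENNReal.ofReal_mul (by positivity), mul_comm] at h
  rw [unitBallVolume, ← h]
  congr 1
  ext z
  simp only [Set.mem_ofPred_eq, Set.mem_preimage, mem_closedBall_zero_iff]
  rw [← sq_le_sq₀ (norm_nonneg _) hR, EuclideanSpace.real_norm_sq_eq]

/-- The volume of a circular cone of height `c` over a base of radius `ρ`. -/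
theorem volume_cone {m : ℕ} (hm : m ≠ 0) {c ρ : ℝ} (hc : 0 < c) (hρ : 0 ≤ ρ) :
    volume {y : EuclideanSpace ℝ (Fin (m + 1)) |
      (0 < y 0 ∧ y 0 < c) ∧ ∑ j : Fin m, y j.succ ^ 2 ≤ (ρ / c * y 0) ^ 2} =
      ENNReal.ofReal (unitBallVolume m * ρ ^ m * c / (m + 1)) := by
  set D : Set (ℝ × (Fin m → ℝ)) :=
    {p | (0 < p.1 ∧ p.1 < c) ∧ ∑ j, p.2 j ^ 2 ≤ (ρ / c * p.1) ^ 2} with hD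
  have hDm : MeasurableSet D := by
    have h1 : MeasurableSet {p : ℝ × (Fin m → ℝ) | 0 < p.1 ∧ p.1 < c} :=
      (measurableSet_lt measurable_const measurable_fst).inter
        (measurableSet_lt measurable_fst measurable_const)
    have h2 : MeasurableSet {p : ℝ × (Fin m → ℝ) | ∑ j, p.2 j ^ 2 ≤ (ρ / c * p.1) ^ 2} :=
      measurableSet_le (by fun_prop) (by fun_prop)
    exact h1.inter h2
  have hpre : volume {y : EuclideanSpace ℝ (Fin (m + 1)) |
      (0 < y 0 ∧ y 0 < c) ∧ ∑ j : Fin m, y j.succ ^ 2 ≤ (ρ / c * y 0) ^ 2} = volume D := by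
    rw [← ((volume_preserving_piFinSuccAbove (fun _ : Fin (m + 1) => ℝ) 0).comp
      (PiLp.volume_preserving_ofLp (Fin (m + 1)))).measure_preimage hDm.nullMeasurableSet]
    rfl
  rw [hpre, Measure.volume_eq_prod, Measure.prod_apply hDm]
  -- The slice at height `a` is a ball of radius `ρ a / c` in dimension `m`.
  have hslice : ∀ a : ℝ, volume (Prod.mk a ⁻¹' D) =
      (Set.Ioo 0 c).indicator
        (fun a => ENNReal.ofReal (unitBallVolume m * (ρ / c) ^ m * a ^ m)) a := by
    intro a
    by_cases ha : a ∈ Set.Ioo 0 c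
    · rw [Set.indicator_of_mem ha, mul_assoc, ← mul_pow,
        ← volume_sum_sq_le hm (mul_nonneg (by positivity) ha.1.le)]
      congr 1
      ext z
      simp only [hD, Set.mem_preimage, Set.mem_ofPred_eq]
      exact ⟨fun h => h.2, fun h => ⟨ha, h⟩⟩
    · rw [Set.indicator_of_notMem ha]
      convert! measure_empty (μ := (volume : Measure (Fin m → ℝ)))
      ext z
      simp only [hD, Set.mem_preimage, Set.mem_ofPred_eq, Set.mem_empty_iff_false, iff_false]
      exact fun h => ha h.1
  simp_rw [hslice]
  rw [lintegral_indicator measurableSet_Ioo, ← ofReal_integral_eq_lintegral_ofReal]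
  · congr 1
    rw [integral_const_mul, ← integral_Ioc_eq_integral_Ioo, ← intervalIntegral.integral_of_le hc.le,
      integral_pow, zero_pow (by omega), div_pow, pow_succ c]
    field_simp
    ring
  · refine IntegrableOn.mono_set (t := Set.Icc 0 c) ?_ Set.Ioo_subset_Icc_self
    exact (Continuous.continuousOn (by fun_prop)).integrableOn_Icc
  · refine (ae_restrict_iff' measurableSet_Ioo).2 (ae_of_all _ fun a ha => ?_)
    have := unitBallVolume_pos m
    have := ha.1
    simp only [Pi.zero_apply]
    positivity

-- The sector over the cap contains a straight cone with apex 0, height `c = √(1 - ρ²)` and base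
-- radius `ρ`, of explicit volume. The opposite cap and the curved part beyond the base are
-- discarded.
open scoped Pointwise in
theorem uniformLaw_first_coord_ge {m : ℕ} (hm : m ≠ 0) {ρ : ℝ} (hρ : 0 ≤ ρ) (hρ1 : ρ < 1) :
    √(1 - ρ ^ 2) * ρ ^ m / √(2 * Real.pi * (m + 1)) ≤
      (uniformLaw (Fin (m + 1))).real
        {x | 1 - (x : EuclideanSpace ℝ (Fin (m + 1))) 0 ^ 2 ≤ ρ ^ 2} := by
  have hc2 : 0 < 1 - ρ ^ 2 := by nlinarith
  set c := √(1 - ρ ^ 2) with hcdef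
  have hc : 0 < c := Real.sqrt_pos.2 hc2
  have hcsq : c ^ 2 = 1 - ρ ^ 2 := Real.sq_sqrt hc2.le
  have hmeas : MeasurableSet {x : UnitVec (Fin (m + 1)) |
      1 - (x : EuclideanSpace ℝ (Fin (m + 1))) 0 ^ 2 ≤ ρ ^ 2} :=
    (isClosed_le (by fun_prop) continuous_const).measurableSet
  have hsub : {y : EuclideanSpace ℝ (Fin (m + 1)) |
      (0 < y 0 ∧ y 0 < c) ∧ ∑ j : Fin m, y j.succ ^ 2 ≤ (ρ / c * y 0) ^ 2} ⊆
      Set.Ioo (0 : ℝ) 1 • (((↑) : UnitVec (Fin (m + 1)) → EuclideanSpace ℝ (Fin (m + 1))) ''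
        {x | 1 - (x : EuclideanSpace ℝ (Fin (m + 1))) 0 ^ 2 ≤ ρ ^ 2}) := by
    rintro y ⟨⟨h0, h1⟩, h2⟩
    have hy : y ≠ 0 := by
      rintro rfl
      simp at h0
    have hn : 0 < ‖y‖ := norm_pos_iff.2 hy
    have hsq : ‖y‖ ^ 2 = y 0 ^ 2 + ∑ j : Fin m, y j.succ ^ 2 := by
      rw [EuclideanSpace.real_norm_sq_eq, Fin.sum_univ_succ]
    have hle : c ^ 2 * ‖y‖ ^ 2 ≤ y 0 ^ 2 := by
      have : c ^ 2 * (ρ / c * y 0) ^ 2 = ρ ^ 2 * y 0 ^ 2 := by field_simp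
      nlinarith [mul_le_mul_of_nonneg_left h2 (sq_nonneg c)]
    -- In the cone `c ‖y‖ ≤ y 0 < c`.
    have hlt : ‖y‖ < 1 := by
      have h3 : c * ‖y‖ ≤ y 0 := by
        rw [← sq_le_sq₀ (by positivity) h0.le, mul_pow]; exact hle
      by_contra hcon
      nlinarith
    refine Set.mem_smul.2 ⟨‖y‖, ⟨hn, hlt⟩, ‖y‖⁻¹ • y,
      ⟨⟨‖y‖⁻¹ • y, by simp [norm_smul, hn.ne']⟩, ?_, rfl⟩, ?_⟩
    · simp only [Set.mem_ofPred_eq, PiLp.smul_apply, smul_eq_mul]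
      rw [mul_pow, inv_pow, ← div_eq_inv_mul]
      have : c ^ 2 ≤ y 0 ^ 2 / ‖y‖ ^ 2 := by rwa [le_div_iff₀ (by positivity)]
      linarith
    · rw [smul_smul, mul_inv_cancel₀ hn.ne', one_smul]
  have hV := unitBallVolume_pos m
  have hV' := unitBallVolume_pos (m + 1)
  have hball : volume (Metric.ball (0 : EuclideanSpace ℝ (Fin (m + 1))) 1) =
      ENNReal.ofReal (unitBallVolume (m + 1)) := by
    rw [EuclideanSpace.volume_ball]
    simp [unitBallVolume]
  rw [measureReal_def, ← ENNReal.ofReal_le_iff_le_toReal (measure_ne_top _ _),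
    uniformLaw_apply hmeas, hball]
  refine le_trans ?_ (ENNReal.div_le_div_right (measure_mono hsub) _)
  rw [volume_cone hm hc hρ, ← ENNReal.ofReal_div_of_pos hV']
  apply ENNReal.ofReal_le_ofReal
  rw [le_div_iff₀ hV']
  have key := sqrt_mul_unitBallVolume_succ_le m
  have e : (1 : ℝ) / √(2 * Real.pi * (m + 1)) = √((m + 1) / (2 * Real.pi)) / (m + 1) := by
    have hm1 : (0 : ℝ) < m + 1 := by positivity
    have hpi := Real.pi_pos
    rw [Real.sqrt_mul (by positivity), Real.sqrt_div hm1.le]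
    have h1 : 0 < √((m : ℝ) + 1) := Real.sqrt_pos.2 hm1
    have h2 : 0 < √(2 * Real.pi) := Real.sqrt_pos.2 (by positivity)
    field_simp
    rw [Real.sq_sqrt hm1.le]
  calc c * ρ ^ m / √(2 * Real.pi * (m + 1)) * unitBallVolume (m + 1)
      = c * ρ ^ m * (1 / √(2 * Real.pi * (m + 1))) * unitBallVolume (m + 1) := by ring
    _ = c * ρ ^ m / (m + 1) * (√((m + 1) / (2 * Real.pi)) * unitBallVolume (m + 1)) := by
        rw [e]; ring
    _ ≤ c * ρ ^ m / (m + 1) * unitBallVolume m := by gcongr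
    _ = unitBallVolume m * ρ ^ m * c / (m + 1) := by ring

/-- A lower bound for the uniform law of a chordal ball. -/
theorem uniformLaw_chordalBall_ge {m : ℕ} (hm : m ≠ 0) {u : EuclideanSpace ℝ (Fin (m + 1))}
    (hu : ‖u‖ = 1) {ρ : ℝ} (hρ : 0 ≤ ρ) (hρ1 : ρ < 1) :
    √(1 - ρ ^ 2) * ρ ^ m / √(2 * Real.pi * (m + 1)) ≤
      (uniformLaw (Fin (m + 1))).real
        {x | chordalDist u (x : EuclideanSpace ℝ (Fin (m + 1))) ≤ ρ} := by
  refine (uniformLaw_first_coord_ge hm hρ hρ1).trans_eq ?_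
  obtain ⟨A, hA⟩ := exists_isometry_map_eq (v := u) (w := EuclideanSpace.single 0 (1 : ℝ))
    (by simp [hu])
  rw [measureReal_def, measureReal_def, ← (measurePreserving_sphereHomeomorph A).measure_preimage
    (isClosed_le (by fun_prop) continuous_const).measurableSet.nullMeasurableSet]
  congr 2
  ext x
  have h0 : (A x) 0 = inner ℝ u (x : EuclideanSpace ℝ (Fin (m + 1))) := by
    rw [← A.inner_map_map, hA, EuclideanSpace.inner_single_left, map_one, one_mul]
  simp only [Set.mem_preimage, Set.mem_ofPred_eq, coe_sphereHomeomorph, h0]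
  rw [← chordalDist_sq hu (by simp), sq_le_sq₀ (chordalDist_nonneg _ _) hρ]

/-! ### Random codebooks and measurability of the quantization error. -/

/-- Independent points with a common law all miss a set with exponentially small probability. -/
theorem measureReal_forall_notMem_le {Ω 𝓧 : Type*} [MeasurableSpace Ω] [MeasurableSpace 𝓧]
    {P : Measure Ω} [IsProbabilityMeasure P] {μ : Measure 𝓧} [IsProbabilityMeasure μ] {N : ℕ}
    {c : Fin N → Ω → 𝓧} (hc : ∀ i, HasLaw (c i) μ P) (hind : iIndepFun c P) {A : Set 𝓧}
    (hA : MeasurableSet A) :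
    P.real {ω | ∀ i, c i ω ∉ A} ≤ Real.exp (-(N * μ.real A)) := by
  have h := hind.measure_inter_preimage_eq_mul Finset.univ (sets := fun _ => Aᶜ)
    fun i _ => hA.compl
  have e : {ω | ∀ i, c i ω ∉ A} = ⋂ i ∈ Finset.univ, c i ⁻¹' Aᶜ := by
    ext ω
    simp
  have hi : ∀ i ∈ Finset.univ, P (c i ⁻¹' Aᶜ) = μ Aᶜ := fun i _ => (hc i).measure_eq hA.compl
  rw [e, measureReal_def, h, Finset.prod_congr rfl hi, Finset.prod_const, Finset.card_univ,
    Fintype.card_fin, ENNReal.toReal_pow, ← measureReal_def, measureReal_compl hA,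
    probReal_univ, ← mul_neg, Real.exp_nat_mul]
  exact pow_le_pow_left₀ (sub_nonneg.2 measureReal_le_one) (Real.one_sub_le_exp_neg _) _

/-- Quantizing to the points nearest to `ref` costs at most the distance to `ref` plus the
distance from `ref` to any of the given points. -/
theorem IsNearestSelection.chordalDist_le {ι κ : Type*} [Fintype ι]
    {ref : EuclideanSpace ℝ ι} {c : κ → UnitVec ι} {N : ℕ} {S : Finset κ}
    (hS : IsNearestSelection ref c N S) (href : ‖ref‖ = 1) (hN : N ≠ 0)
    {x : EuclideanSpace ℝ ι} (hx : ‖x‖ = 1) {y : UnitVec ι}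
    (hy : IsChordalQuantization (c '' (S : Set κ)) x y) (j : κ) :
    chordalDist x y ≤ chordalDist x ref + chordalDist ref (c j) := by
  -- If `j` was not selected, any selected index is at least as close; one exists because `N ≠ 0`.
  obtain ⟨i, hi, hij⟩ : ∃ i ∈ S, chordalDist ref (c i) ≤ chordalDist ref (c j) := by
    by_cases hj : j ∈ S
    · exact ⟨j, hj, le_rfl⟩
    · obtain ⟨i, hi⟩ := Finset.card_ne_zero.1 (hS.card_eq.trans_ne hN)
      exact ⟨i, hi, hS.nearest i hi j hj⟩
  calc chordalDist x y ≤ chordalDist x (c i) := hy.2 _ ⟨i, hi, rfl⟩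
    _ ≤ chordalDist x ref + chordalDist ref (c i) := chordalDist_triangle hx href (by simp)
    _ ≤ _ := by gcongr

theorem IsChordalQuantization.chordalDist_eq_iInf {ι κ : Type*} [Fintype ι]
    {c : κ → UnitVec ι} {S : Finset κ} {x : EuclideanSpace ℝ ι} {y : UnitVec ι}
    (hy : IsChordalQuantization (c '' (S : Set κ)) x y) :
    chordalDist x y = ⨅ i : S, chordalDist x (c i) := by
  obtain ⟨⟨i, hi, hiy⟩, hmin⟩ := hy
  have : Nonempty S := ⟨⟨i, hi⟩⟩
  refine le_antisymm (le_ciInf fun j => hmin _ ⟨j, j.2, rfl⟩) ?_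
  rw [← hiy]
  exact ciInf_le (Set.finite_range _).bddBelow (⟨i, hi⟩ : S)

/-- A function chosen among finitely many by a random index is measurable. -/
theorem aemeasurable_of_finite_choice {Ω κ : Type*} [MeasurableSpace Ω] [Fintype κ]
    {P : Measure Ω} {F : κ → Ω → ℝ} (hF : ∀ k, AEMeasurable (F k) P) {S : Ω → κ}
    (hS : ∀ k, MeasurableSet {ω | S ω = k}) : AEMeasurable (fun ω => F (S ω) ω) P := by
  classical
  have : (fun ω => F (S ω) ω) = fun ω => ∑ k, {ω | S ω = k}.indicator (F k) ω := by
    ext ω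
    simp [Set.indicator_apply]
  rw [this]
  exact Finset.aemeasurable_fun_sum _ fun k _ => (hF k).indicator (hS k)

theorem aemeasurable_chordalDist {Ω ι : Type*} [MeasurableSpace Ω] [Fintype ι]
    {P : Measure Ω} {x y : Ω → EuclideanSpace ℝ ι} (hx : AEMeasurable x P)
    (hy : AEMeasurable y P) : AEMeasurable (fun ω => chordalDist (x ω) (y ω)) P := by
  unfold chordalDist
  fun_prop

/-- The quantizer `q` itself need not be measurable: the error is a minimum over the selected
indices, and the selection takes finitely many values. -/
theorem aemeasurable_chordalDist_quantization {Ω ι κ : Type*} [MeasurableSpace Ω] [Fintype ι]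
    [Fintype κ] {P : Measure Ω} {x : Ω → EuclideanSpace ℝ ι} (hx : AEMeasurable x P)
    {c : κ → Ω → UnitVec ι} (hc : ∀ i, AEMeasurable (c i) P) {S : Ω → Finset κ}
    (hS : ∀ T, MeasurableSet {ω | S ω = T}) {q : Ω → UnitVec ι}
    (hq : ∀ ω, IsChordalQuantization ((fun i => c i ω) '' (S ω : Set κ)) (x ω) (q ω)) :
    AEMeasurable (fun ω => chordalDist (x ω) (q ω)) P := by
  have e : (fun ω => chordalDist (x ω) (q ω)) =
      fun ω => ⨅ i : S ω, chordalDist (x ω) (c i ω) :=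
    funext fun ω => (hq ω).chordalDist_eq_iInf
  have hF (T : Finset κ) : AEMeasurable (fun ω => ⨅ i : T, chordalDist (x ω) (c i ω)) P := by
    refine AEMeasurable.iInf fun i => ?_
    exact aemeasurable_chordalDist hx (measurable_subtype_coe.comp_aemeasurable (hc i))
  rw [e]
  exact aemeasurable_of_finite_choice hF hS

/-! ### The sampling radius and the number of points it captures. -/

theorem one_le_hingeBeta {L : ℕ} (hL : 1 ≤ L) : 1 ≤ hingeBeta L := by
  have hL1 : (1 : ℝ) ≤ (L : ℝ) ^ (1 / 4 : ℝ) :=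
    Real.one_le_rpow (by exact_mod_cast hL) (by norm_num)
  have h0 : 0 ≤ hingeRadius L := Real.sqrt_nonneg _
  have h1 : hingeRadius L < 1 := by
    rw [hingeRadius, Real.sqrt_lt' one_pos, one_pow, div_lt_one (by positivity)]
    linarith
  have h2 : hingeRadius L ^ (1 / 2 : ℝ) < 1 := Real.rpow_lt_one h0 h1 (by norm_num)
  have h3 : 0 ≤ hingeRadius L ^ (1 / 2 : ℝ) := Real.rpow_nonneg h0 _
  rw [hingeBeta, le_div_iff₀ (by linarith)]
  linarith

/-- The chordal radius within which one of the sampled points is expected. -/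
noncomputable def sampleRadius (m L B : ℕ) : ℝ :=
  (2 : ℝ) ^ (-(B : ℝ) / m) * (L : ℝ) ^ (-(1 / 4) : ℝ)

theorem sampleRadius_nonneg (m L B : ℕ) : 0 ≤ sampleRadius m L B := by
  unfold sampleRadius
  positivity

theorem sampleRadius_sq (m L B : ℕ) :
    sampleRadius m L B ^ 2 =
      (L : ℝ) ^ (-(1 / 2) : ℝ) * (2 : ℝ) ^ (-(2 * (B : ℝ)) / m) := by
  rw [sampleRadius, mul_pow, ← Real.rpow_mul_natCast (by norm_num),
    ← Real.rpow_mul_natCast (by positivity), mul_comm]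
  congr 2
  · norm_num
  · push_cast; ring

theorem sampleRadius_sq_le (m L B : ℕ) :
    sampleRadius m L B ^ 2 ≤ (L : ℝ) ^ (-(1 / 2) : ℝ) := by
  rw [sampleRadius_sq]
  refine mul_le_of_le_one_right (by positivity)
    (Real.rpow_le_one_of_one_le_of_nonpos (by norm_num) ?_)
  rw [neg_div]
  exact neg_nonpos.2 (by positivity)

theorem sampleRadius_pow {m L : ℕ} (hm : m ≠ 0) (B : ℕ) :
    sampleRadius m L B ^ m = (2 : ℝ) ^ (-(B : ℝ)) * (L : ℝ) ^ (-(m / 4 : ℝ)) := by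
  rw [sampleRadius, mul_pow, ← Real.rpow_mul_natCast (by norm_num),
    ← Real.rpow_mul_natCast (by positivity)]
  have : (m : ℝ) ≠ 0 := by exact_mod_cast hm
  congr 2
  · field_simp
  · ring

/-- Ensures that rounding down loses at most a factor 2. -/
theorem one_le_sampleSize {m L : ℕ} (hm : m ≠ 0) (hL : 1 ≤ L) (B : ℕ) :
    1 ≤ sampleSize (m + 1) L B := by
  have hL1 : (1 : ℝ) ≤ (L : ℝ) ^ ((m : ℝ) / 4 + 1) :=
    Real.one_le_rpow (by exact_mod_cast hL) (by positivity)
  have hm1 : (1 : ℝ) ≤ m := by exact_mod_cast Nat.one_le_iff_ne_zero.2 hm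
  have h2 : (1 : ℝ) ≤ 2 ^ B := one_le_pow₀ (by norm_num)
  have h3 : (1 : ℝ) ≤ 2 * ((m : ℝ) / 2) ^ (1 / 2 : ℝ) * √Real.pi := by
    rw [← Real.sqrt_eq_rpow, mul_assoc, ← Real.sqrt_mul (by positivity)]
    have : (1 : ℝ) ≤ √(m / 2 * Real.pi) :=
      Real.one_le_sqrt.2 (by nlinarith [Real.pi_gt_three])
    linarith
  have e : sampleSize (m + 1) L B = 2 ^ B * (L : ℝ) ^ ((m : ℝ) / 4 + 1) *
      (2 * ((m : ℝ) / 2) ^ (1 / 2 : ℝ) * √Real.pi) := by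
    rw [sampleSize]
    push_cast
    rw [add_sub_cancel_right]
    ring
  rw [e]
  exact one_le_mul_of_one_le_of_one_le (one_le_mul_of_one_le_of_one_le h2 hL1) h3

/-- The powers of 2 and `L` cancel in `sampleSize * ρ ^ m = 2 L √(π m / 2)`. The rest is `1 - ρ² ≥ 1
/ 2`, which needs `L ≥ 4`, and `m + 1 ≤ 2 m`. -/
theorem le_sampleSize_mul {m L : ℕ} (hm : m ≠ 0) (hL : 4 ≤ L) (B : ℕ) :
    (L : ℝ) / 2 ≤ sampleSize (m + 1) L B *
      (√(1 - sampleRadius m L B ^ 2) * sampleRadius m L B ^ m / √(2 * Real.pi * (m + 1))) := by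
  have hL0 : (0 : ℝ) < L := by exact_mod_cast (by omega : 0 < L)
  have hm1 : (1 : ℝ) ≤ m := by exact_mod_cast Nat.one_le_iff_ne_zero.2 hm
  have hr : sampleRadius m L B ^ 2 ≤ 1 / 2 := by
    refine (sampleRadius_sq_le m L B).trans ?_
    calc (L : ℝ) ^ (-(1 / 2) : ℝ) ≤ (4 : ℝ) ^ (-(1 / 2) : ℝ) :=
          Real.rpow_le_rpow_of_nonpos (by norm_num) (by exact_mod_cast hL) (by norm_num)
      _ = 1 / 2 := by
          rw [Real.rpow_neg (by norm_num), ← Real.sqrt_eq_rpow,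
            show (4 : ℝ) = 2 ^ 2 by norm_num, Real.sqrt_sq (by norm_num)]
          norm_num
  have hs : √(1 / 2) ≤ √(1 - sampleRadius m L B ^ 2) := Real.sqrt_le_sqrt (by linarith)
  have hq : √(1 / 2) * √(2 * Real.pi * (m + 1)) ≤ 2 * (√(m / 2) * √Real.pi) := by
    rw [← Real.sqrt_mul (by norm_num), ← Real.sqrt_mul (by positivity),
      Real.sqrt_le_left (by positivity), mul_pow, Real.sq_sqrt (by positivity)]
    nlinarith [Real.pi_pos]
  have hprod : sampleSize (m + 1) L B * sampleRadius m L B ^ m =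
      2 * L * (√(m / 2) * √Real.pi) := by
    rw [sampleRadius_pow hm, sampleSize]
    push_cast
    rw [add_sub_cancel_right, Real.rpow_add hL0, Real.rpow_one, Real.rpow_neg (by norm_num),
      Real.rpow_neg hL0.le, Real.rpow_natCast, ← Real.sqrt_eq_rpow, pow_succ]
    field_simp
  have hd : 0 < √(2 * Real.pi * (m + 1)) := Real.sqrt_pos.2 (by positivity)
  have hh : √(1 / 2 : ℝ) * √(1 / 2) = 1 / 2 := Real.mul_self_sqrt (by norm_num)
  rw [← mul_div_assoc, le_div_iff₀ hd]
  calc (L : ℝ) / 2 * √(2 * Real.pi * (m + 1))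
      = L * √(1 / 2) * (√(1 / 2) * √(2 * Real.pi * (m + 1))) := by
        linear_combination (-(L * √(2 * Real.pi * (m + 1)))) * hh
    _ ≤ L * √(1 - sampleRadius m L B ^ 2) * (2 * (√(m / 2) * √Real.pi)) := by gcongr
    _ = √(1 - sampleRadius m L B ^ 2) * (2 * L * (√(m / 2) * √Real.pi)) := by ring
    _ = _ := by rw [← hprod]; ring

/-- With high probability one of the sampled points is within `sampleRadius` of the reference. -/
theorem measureReal_forall_far_le {Ω : Type*} [MeasurableSpace Ω] {P : Measure Ω}
    [IsProbabilityMeasure P] {m L B N : ℕ} (hm : m ≠ 0) (hL : 4 ≤ L)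
    (hN : ⌊sampleSize (m + 1) L B⌋₊ ≤ N) {c : Fin N → Ω → UnitVec (Fin (m + 1))}
    (hc : ∀ i, HasLaw (c i) (uniformLaw (Fin (m + 1))) P) (hind : iIndepFun c P)
    {u : EuclideanSpace ℝ (Fin (m + 1))} (hu : ‖u‖ = 1) :
    P.real {ω | ∀ i, ¬ chordalDist u (c i ω : EuclideanSpace ℝ (Fin (m + 1))) ≤
      sampleRadius m L B} ≤ 32 * (L : ℝ) ^ (-(3 / 2) : ℝ) := by
  have hL0 : (1 : ℝ) ≤ L := by exact_mod_cast (by omega : 1 ≤ L)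
  have hr1 : sampleRadius m L B < 1 := by
    have h1 : (L : ℝ) ^ (-(1 / 2) : ℝ) < 1 :=
      Real.rpow_lt_one_of_one_lt_of_neg (by exact_mod_cast (by omega : 1 < L)) (by norm_num)
    have h2 := sampleRadius_sq_le m L B
    nlinarith [sampleRadius_nonneg m L B]
  have hA : MeasurableSet {x : UnitVec (Fin (m + 1)) |
      chordalDist u (x : EuclideanSpace ℝ (Fin (m + 1))) ≤ sampleRadius m L B} :=
    (isClosed_le (continuous_chordalDist.comp
      (continuous_const.prodMk continuous_subtype_val)) continuous_const).measurableSet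
  refine (measureReal_forall_notMem_le hc hind hA).trans ?_
  have hp := uniformLaw_chordalBall_ge hm hu (sampleRadius_nonneg m L B) hr1
  set p := (uniformLaw (Fin (m + 1))).real
    {x | chordalDist u (x : EuclideanSpace ℝ (Fin (m + 1))) ≤ sampleRadius m L B} with hpdef
  have hp0 : 0 ≤ p := measureReal_nonneg
  have hs1 := one_le_sampleSize hm (by omega : 1 ≤ L) B
  have hsN : sampleSize (m + 1) L B / 2 ≤ N := by
    have h1 : (1 : ℝ) ≤ (⌊sampleSize (m + 1) L B⌋₊ : ℝ) := by
      exact_mod_cast Nat.le_floor (by exact_mod_cast hs1)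
    have h2 := Nat.lt_floor_add_one (sampleSize (m + 1) L B)
    have h3 : (⌊sampleSize (m + 1) L B⌋₊ : ℝ) ≤ N := by exact_mod_cast hN
    linarith
  have hNp : (L : ℝ) / 4 ≤ N * p := by
    have h1 := le_sampleSize_mul hm hL B
    have h2 := mul_le_mul_of_nonneg_left hp (by linarith : 0 ≤ sampleSize (m + 1) L B)
    have h3 := mul_le_mul_of_nonneg_right hsN hp0
    linarith
  -- The quadratic Taylor term of the exponential, `(L / 4)² / 2`.
  have hexp : (L : ℝ) ^ 2 / 32 ≤ Real.exp (L / 4) := by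
    have := Real.quadratic_le_exp_of_nonneg (by positivity : (0 : ℝ) ≤ L / 4)
    nlinarith
  calc Real.exp (-(N * p)) ≤ Real.exp (-(L / 4)) := Real.exp_le_exp.2 (by linarith)
    _ = (Real.exp (L / 4))⁻¹ := Real.exp_neg _
    _ ≤ ((L : ℝ) ^ 2 / 32)⁻¹ := inv_anti₀ (by positivity) hexp
    _ = 32 * (L : ℝ) ^ (-2 : ℝ) := by
        rw [Real.rpow_neg (by positivity), Real.rpow_two, inv_div, div_eq_mul_inv]
    _ ≤ 32 * (L : ℝ) ^ (-(3 / 2) : ℝ) := by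
        gcongr
        norm_num

/-! ### The bound on the expected quantization error. -/

theorem mainTheorem4 :
    ∃ K : ℝ, ∀ (M L B N' : ℕ), 2 ≤ M → 1 ≤ L → ⌊sampleSize M L B⌋₊ ≤ N' →
      ∀ (Ω : Type*) [MeasurableSpace Ω] (P : Measure Ω) [IsProbabilityMeasure P]
        (f : Ω → UnitVec (Fin M × Fin L)) (c : Fin N' → Ω → UnitVec (Fin M))
        (S : Ω → Finset (Fin N')) (q : Ω → UnitVec (Fin M)),
        HasLaw f (uniformLaw (Fin M × Fin L)) P →
        (∀ i, HasLaw (c i) (uniformLaw (Fin M)) P) →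
        iIndepFun c P →
        IndepFun f (fun ω i => c i ω) P →
        (∀ T : Finset (Fin N'), MeasurableSet {ω | S ω = T}) →
        (∀ ω, IsNearestSelection (hRef M) (fun i => c i ω) (2 ^ B) (S ω)) →
        (∀ ω, IsChordalQuantization ((fun i => c i ω) '' (S ω : Set (Fin N')))
          (hingeVector (f ω : EuclideanSpace ℝ (Fin M × Fin L))) (q ω)) →
        Integrable (fun ω => chordalDist (hingeVector (f ω : EuclideanSpace ℝ (Fin M × Fin L)))
          (q ω : EuclideanSpace ℝ (Fin M)) ^ 2) P ∧
        ∫ ω, chordalDist (hingeVector (f ω : EuclideanSpace ℝ (Fin M × Fin L)))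
            (q ω : EuclideanSpace ℝ (Fin M)) ^ 2 ∂P ≤
          (L : ℝ) ^ (-(1 / 2) : ℝ) *
              (hingeBeta L * (2 : ℝ) ^ (-(2 * (B : ℝ)) / ((M : ℝ) - 1)) + 1) +
            K * (L : ℝ) ^ (-(3 / 2) : ℝ) := by
  -- `1728 = 144 ^ (3 / 2)` makes the bound trivial for `L < 144`, and it exceeds the 32 of the
  -- failure probability.
  refine ⟨1728, fun M L B N' hM hL hN Ω _ P _ f c S q hf hc hind _ hS hnear hq => ?_⟩
  obtain ⟨m, rfl⟩ : ∃ m, M = m + 1 := ⟨M - 1, by omega⟩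
  have hm : m ≠ 0 := by omega
  have hL0 : (0 : ℝ) < L := by exact_mod_cast hL
  have hβ := one_le_hingeBeta hL
  have hx : AEMeasurable
      (fun ω => hingeVector (f ω : EuclideanSpace ℝ (Fin (m + 1) × Fin L))) P :=
    (continuous_hingeVector.comp continuous_subtype_val).measurable.comp_aemeasurable
      hf.aemeasurable
  have hnorm : ∀ ω, ‖hingeVector (f ω : EuclideanSpace ℝ (Fin (m + 1) × Fin L))‖ = 1 :=
    fun ω => by rw [norm_hingeVector]; simp
  have hnref : ‖hRef (m + 1)‖ = 1 := norm_hRef (by omega)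
  set d : Ω → ℝ := fun ω => chordalDist
    (hingeVector (f ω : EuclideanSpace ℝ (Fin (m + 1) × Fin L)))
    (q ω : EuclideanSpace ℝ (Fin (m + 1))) with hd
  have hd0 : ∀ ω, 0 ≤ d ω := fun ω => chordalDist_nonneg _ _
  have hd1 : ∀ ω, d ω ^ 2 ≤ 1 := fun ω => pow_le_one₀ (hd0 ω) (chordalDist_le_one _ _)
  have hint : Integrable (fun ω => d ω ^ 2) P := by
    refine Integrable.of_bound ((aemeasurable_chordalDist_quantization hx
      (fun i => (hc i).aemeasurable) hS hq).pow_const 2).aestronglyMeasurable 1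
      (ae_of_all _ fun ω => ?_)
    rw [Real.norm_eq_abs, abs_of_nonneg (sq_nonneg _)]
    exact hd1 ω
  refine ⟨hint, ?_⟩
  push_cast
  rw [add_sub_cancel_right]
  set s := (L : ℝ) ^ (-(1 / 2) : ℝ) with hs
  set t := (2 : ℝ) ^ (-(2 * (B : ℝ)) / m) with ht
  have hs0 : 0 < s := by positivity
  have ht0 : 0 < t := by positivity
  have hst : s * t ≤ s * (hingeBeta L * t) := by
    gcongr
    exact le_mul_of_one_le_left ht0.le hβ
  rcases lt_or_ge L 144 with hsmall | hlarge
  · have h1 : ∫ ω, d ω ^ 2 ∂P ≤ 1 := by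
      calc _ ≤ ∫ _, (1 : ℝ) ∂P := integral_mono hint (integrable_const _) hd1
        _ = 1 := by simp
    have h2 : (1 : ℝ) ≤ 1728 * (L : ℝ) ^ (-(3 / 2) : ℝ) := by
      have : (144 : ℝ) ^ (-(3 / 2) : ℝ) ≤ (L : ℝ) ^ (-(3 / 2) : ℝ) :=
        Real.rpow_le_rpow_of_nonpos hL0 (by exact_mod_cast hsmall.le) (by norm_num)
      have e : (144 : ℝ) ^ (-(3 / 2) : ℝ) = 1 / 1728 := by
        rw [show (144 : ℝ) = 12 ^ (2 : ℝ) by norm_num, ← Real.rpow_mul (by norm_num)]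
        norm_num
      linarith
    nlinarith [mul_pos hs0 ht0]
  · set ρ := sampleRadius m L B with hρ
    have hρ0 : 0 ≤ ρ := sampleRadius_nonneg _ _ _
    have hρs : ρ ^ 2 ≤ s := sampleRadius_sq_le _ _ _
    have hρst : ρ ^ 2 = s * t := sampleRadius_sq _ _ _
    set far : Set Ω := {ω | ∀ i, ¬ chordalDist (hRef (m + 1))
      (c i ω : EuclideanSpace ℝ (Fin (m + 1))) ≤ ρ} with hfar
    have hfarP : P.real far ≤ 32 * (L : ℝ) ^ (-(3 / 2) : ℝ) :=
      measureReal_forall_far_le hm (by omega) hN hc hind hnref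
    set g : UnitVec (Fin (m + 1) × Fin L) → ℝ := fun x => chordalDist
      (hingeVector (x : EuclideanSpace ℝ (Fin (m + 1) × Fin L))) (hRef (m + 1)) ^ 2 with hg
    have hgc : Continuous g := (continuous_chordalDist.comp ((continuous_hingeVector.comp
      continuous_subtype_val).prodMk continuous_const)).pow 2
    have hgi : Integrable (g ∘ f) P := by
      refine Integrable.of_bound (hgc.measurable.comp_aemeasurable
        hf.aemeasurable).aestronglyMeasurable 1 (ae_of_all _ fun ω => ?_)
      rw [Real.norm_eq_abs, abs_of_nonneg (sq_nonneg _)]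
      exact pow_le_one₀ (chordalDist_nonneg _ _) (chordalDist_le_one _ _)
    have hgE : ∫ ω, (g ∘ f) ω ∂P ≤ 2 / L := by
      rw [hf.integral_comp hgc.aestronglyMeasurable]
      exact integral_chordalDist_hingeVector_hRef_sq_le (by omega) hL
    have hnull : NullMeasurableSet far P := by
      rw [hfar, Set.ofPred_forall]
      refine NullMeasurableSet.iInter fun i => NullMeasurableSet.compl ?_
      exact nullMeasurableSet_le (aemeasurable_chordalDist aemeasurable_const
        (measurable_subtype_coe.comp_aemeasurable (hc i).aemeasurable)) aemeasurable_const
    have hfarI : Integrable (far.indicator fun _ => (1 : ℝ)) P :=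
      (integrable_const _).indicator₀ hnull
    have hpt : ∀ ω, d ω ^ 2 ≤
        far.indicator (fun _ => (1 : ℝ)) ω + (ρ ^ 2 + s / 2) + 3 * (g ∘ f) ω := by
      intro ω
      have hg0 : 0 ≤ (g ∘ f) ω := sq_nonneg _
      by_cases hω : ω ∈ far
      · rw [Set.indicator_of_mem hω]
        nlinarith [hd1 ω]
      · rw [Set.indicator_of_notMem hω]
        obtain ⟨i, hi⟩ : ∃ i, chordalDist (hRef (m + 1))
            (c i ω : EuclideanSpace ℝ (Fin (m + 1))) ≤ ρ := by
          simpa [hfar] using hω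
        have h1 := (hnear ω).chordalDist_le hnref (by positivity) (hnorm ω) (hq ω) i
        set δ := chordalDist (hingeVector (f ω : EuclideanSpace ℝ (Fin (m + 1) × Fin L)))
          (hRef (m + 1)) with hδ
        have hgδ : (g ∘ f) ω = δ ^ 2 := rfl
        have h2 : d ω ≤ δ + ρ := h1.trans (by gcongr)
        rw [hgδ]
        have h3 : d ω ^ 2 ≤ (δ + ρ) ^ 2 := by gcongr; exact hd0 ω
        -- `2 δ ρ ≤ 2 δ² + ρ² / 2`, then `ρ² ≤ s`.
        nlinarith [sq_nonneg (2 * δ - ρ)]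
    have hE : ∫ ω, d ω ^ 2 ∂P ≤ P.real far + (ρ ^ 2 + s / 2) + 3 * (2 / L) := by
      calc _ ≤ ∫ ω, (far.indicator (fun _ => (1 : ℝ)) ω + (ρ ^ 2 + s / 2) + 3 * (g ∘ f) ω) ∂P :=
            integral_mono hint ((hfarI.add (integrable_const _)).add (hgi.const_mul 3)) hpt
        _ = P.real far + (ρ ^ 2 + s / 2) + 3 * ∫ ω, (g ∘ f) ω ∂P := by
            rw [integral_add (f := fun ω => far.indicator (fun _ => (1 : ℝ)) ω + (ρ ^ 2 + s / 2))
                (hfarI.add (integrable_const _)) (hgi.const_mul 3),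
              integral_add hfarI (integrable_const _), integral_const_mul,
              integral_indicator₀ hnull]
            simp
        _ ≤ _ := by gcongr
    -- With `s² = 1 / L` this reads `6 s² ≤ s / 2`, that is `s ≤ 1 / 12`, whence the threshold 144.
    have hL6 : 3 * (2 / (L : ℝ)) ≤ s / 2 := by
      have hss : s * s = 1 / L := by
        rw [hs, ← Real.rpow_add hL0]
        norm_num [Real.rpow_neg_one]
      have hs12 : s ≤ 1 / 12 := by
        have : (144 : ℝ) ≤ L := by exact_mod_cast hlarge
        have h4 : s * s ≤ 1 / 144 := by
          rw [hss]
          exact one_div_le_one_div_of_le (by norm_num) this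
        nlinarith
      have : 3 * (2 / (L : ℝ)) = 6 * (s * s) := by rw [hss]; ring
      nlinarith
    have hpos : 0 ≤ (L : ℝ) ^ (-(3 / 2) : ℝ) := by positivity
    linarith
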